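/- **Conventions.** Let $k\in\mathbb{N}$ and regard $\mathbb{N}^k$ as a category with one object and composition given by addition. A $k$-graph is a countable category $\Lambda$, with range and source maps $r,s$, together with a functor $d:\Lambda\to\mathbb{N}^k$ such that whenever $d(\lambda)=m+n$ there are unique $\mu,\nu\in\Lambda$ with $d(\mu)=m$, $d(\nu)=n$ and $\lambda=\mu\nu$. The set $\Lambda^0$ of objects (vertices) is identified with the set of morphisms of degree $0$. Write $\Lambda^{\neq 0}$ for the set of morphisms of nonzero degree, $v\Lambda=\{\lambda: r(\lambda)=v\}$, $v\Lambda^n=\{\lambda\in v\Lambda: d(\lambda)=n\}$ and $v\Lambda w=\{\lambda\in v\Lambda : s(\lambda)=w\}$. For $0\le p\le q\le d(\lambda)$, $\lambda(p,q)$ denotes the unique path of degree $q-p$ such that $\lambda=\lambda'\lambda(p,q)\lambda''$ with $d(\lambda')=p$. The $k$-graph $\Lambda$ is *row-finite* if every $v\Lambda^n$ is finite and has *no sources* if every $v\Lambda^n$ is nonempty ($v\in\Lambda^0$, $n\in\mathbb{N}^k$). $\Lambda$ is *aperiodic* if for every $v\in\Lambda^0$ and all $m\ne n$ in $\mathbb{N}^k$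 there is $\lambda\in v\Lambda$ with $d(\lambda)\ge m\vee n$ and $$\lambda(m,m+d(\lambda)-(m\vee n))\neq\lambda(n,n+d(\lambda)-(m\vee n)).$$ Let $\Omega_k=\{(m,n)\in\mathbb{N}^k\times\mathbb{N}^k: m\le n\}$ be the category with $r(m,n)=m$, $s(m,n)=n$, composition $(l,m)(m,n)=(l,n)$ and degree $d(m,n)=n-m$. An *infinite path* is a degree-preserving functor $x:\Omega_k\to\Lambda$; write $x(m)$ for the vertex $x(m,m)$. $\Lambda$ is *cofinal* if for every infinite path $x$ and every $v\in\Lambda^0$ there is $m\in\mathbb{N}^k$ with $v\Lambda x(m)\neq\emptyset$. For a row-finite $k$-graph $\Lambda$ with no sources and a commutative ring $R$ with $1$, the *Kumjian–Pask algebra* $\mathrm{KP}_R(\Lambda)$ is the universal (associative, not necessarily unital) $R$-algebra generated by elements $p_v$ ($v\in\Lambda^0$) and $s_\lambda,s_{\lambda^*}$ ($\lambda\in\Lambda^{\neq0}$) subject to: - (KP1) the $p_v$ are mutually orthogonal idempotents; - (KP2) for $\lambda,\mu\in\Lambda^{\neq0}$ with $r(\mu)=s(\lambda)$: $s_\lambda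 s_\mu=s_{\lambda\mu}$ and $s_{\mu^*}s_{\lambda^*}=s_{(\lambda\mu)^*}$; and for $\lambda\in\Lambda^{\neq0}$: $p_{r(\lambda)}s_\lambda=s_\lambda=s_\lambda p_{s(\lambda)}$ and $p_{s(\lambda)}s_{\lambda^*}=s_{\lambda^*}=s_{\lambda^*}p_{r(\lambda)}$; - (KP3) for $\lambda,\mu\in\Lambda^{\neq0}$ with $d(\lambda)=d(\mu)$: $s_{\lambda^*}s_\mu=\delta_{\lambda,\mu}\,p_{s(\lambda)}$; - (KP4) for $v\in\Lambda^0$ and $n\in\mathbb{N}^k\setminus\{0\}$: $p_v=\sum_{\lambda\in v\Lambda^n}s_\lambda s_{\lambda^*}$. $Z(A)=\{a\in A: ab=ba\text{ for all }b\in A\}$ denotes the center of an algebra $A$. **Theorem.** Let $\Lambda$ be a row-finite $k$-graph with no sources and let $R$ be a commutative ring with $1$. 1. If $\Lambda$ is aperiodic and cofinal and $\Lambda^0$ is finite, then $\mathrm{KP}_R(\Lambda)$ has an identity $1_{\mathrm{KP}_R(\Lambda)}$ and $Z(\mathrm{KP}_R(\Lambda))=R\,1_{\mathrm{KP}_R(\Lambda)}$.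 2. If $\Lambda$ is cofinal and $\Lambda^0$ is infinite, then $Z(\mathrm{KP}_R(\Lambda))=\{0\}$. -/

import Mathlib

open CategoryTheory

universe u v w

/-- A `k`-graph: a countable (small) category `Λ` together with a degree functor
`d : Λ → ℕ^k` (`ℕ^k` being the one-object category given by addition) which has the unique
factorization property.

A morphism `f : u ⟶ v` is a path with source `s(f) = u` and range `r(f) = v`. The composite
written `λμ` for paths with `s(λ) = r(μ)` is `μ ≫ λ` in Mathlib's notation. The vertices are
the objects of `Λ`. -/
structure KGraph (k : ℕ) (Λ : Type u) [Category.{v} Λ] where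
  /-- The degree of a path. -/
  d : ∀ {u v : Λ}, (u ⟶ v) → (Fin k → ℕ)
  countable_obj : Countable Λ
  countable_hom : ∀ u v : Λ, Countable (u ⟶ v)
  d_id : ∀ v : Λ, d (𝟙 v) = 0
  d_comp : ∀ {u v w : Λ} (f : u ⟶ v) (g : v ⟶ w), d (f ≫ g) = d g + d f
  /-- If `d(f) = m + n`, then `f = μν` for exactly one pair of paths with `d(μ) = m`,
  `d(ν) = n`; the first component of the triple is the vertex `s(μ) = r(ν)`. -/
  factorization : ∀ {u v : Λ} (f : u ⟶ v) (m n : Fin k → ℕ), d f = m + n →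
    ∃! p : (Σ x : Λ, (x ⟶ v) × (u ⟶ x)), d p.2.1 = m ∧ d p.2.2 = n ∧ p.2.2 ≫ p.2.1 = f

namespace KGraph

/-- The type of all paths (morphisms), with their source and range. -/
@[ext]
structure Path (Λ : Type u) [Category.{v} Λ] where
  {src : Λ}
  {rng : Λ}
  hom : src ⟶ rng

variable {k : ℕ} {Λ : Type u} [Category.{v} Λ] (G : KGraph k Λ)

/-- The degree of a bundled path. -/
def deg (p : Path Λ) : Fin k → ℕ := G.d p.hom

/-- The set `vΛ^n` of paths with range `v` and degree `n`. -/
def Into (v : Λ) (n : Fin k → ℕ) : Type (max u v) :=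
  {p : Path Λ // p.rng = v ∧ G.deg p = n}

/-- `vΛ^n` is finite for all `v` and `n`. -/
def RowFinite : Prop := ∀ (v : Λ) (n : Fin k → ℕ), Finite (G.Into v n)

/-- `vΛ^n` is nonempty for all `v` and `n`. -/
def NoSources : Prop := ∀ (v : Λ) (n : Fin k → ℕ), Nonempty (G.Into v n)

/-- `G.IsSegment f p q g` says that `g = f(p, q)`, that is, `f = a g b` with `d(a) = p` and
`d(a g) = q`. -/
def IsSegment {u v : Λ} (f : u ⟶ v) (p q : Fin k → ℕ) (g : Path Λ) : Prop :=
  ∃ (a : g.rng ⟶ v) (b : u ⟶ g.src), b ≫ g.hom ≫ a = f ∧ G.d a = p ∧ p + G.deg g = q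

/-- For every vertex `v` and all `m ≠ n` there is a path `f` with range `v` and
`d(f) ≥ m ∨ n` such that
`f(m, m + d(f) - (m ∨ n)) ≠ f(n, n + d(f) - (m ∨ n))`. -/
def Aperiodic : Prop :=
  ∀ (v : Λ) (m n : Fin k → ℕ), m ≠ n →
    ∃ (u : Λ) (f : u ⟶ v), m ⊔ n ≤ G.d f ∧
      ∃ g h : Path Λ, G.IsSegment f m (m + (G.d f - m ⊔ n)) g ∧
        G.IsSegment f n (n + (G.d f - m ⊔ n)) h ∧ g ≠ h

/-- An infinite path: a degree-preserving functor from the category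
`Ω_k = {(m, n) : m ≤ n}` (with `r(m, n) = m`, `s(m, n) = n` and `d(m, n) = n - m`) to `Λ`. -/
structure InfinitePath where
  /-- The vertex `x(m) = x(m, m)`. -/
  vertex : (Fin k → ℕ) → Λ
  /-- The path `x(m, n)`. -/
  seg : ∀ {m n : Fin k → ℕ}, m ≤ n → (vertex n ⟶ vertex m)
  seg_refl : ∀ m : Fin k → ℕ, seg (le_refl m) = 𝟙 (vertex m)
  seg_comp : ∀ {l m n : Fin k → ℕ} (h : l ≤ m) (h' : m ≤ n),
    seg h' ≫ seg h = seg (h.trans h')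
  d_seg : ∀ {m n : Fin k → ℕ} (h : m ≤ n), G.d (seg h) = n - m

/-- For every infinite path `x` and every vertex `v` there is an `m` such that there is a path
with range `v` and source `x(m)`. -/
def Cofinal : Prop :=
  ∀ (x : G.InfinitePath) (v : Λ), ∃ m : Fin k → ℕ, Nonempty (x.vertex m ⟶ v)

/-- The generators of the Kumjian-Pask algebra: the vertices, the paths of nonzero degree and
the ghost paths `λ*` of nonzero degree. -/
inductive Gen : Type (max u v)
  | vertex (v : Λ)
  | path (p : Path Λ) (hp : G.deg p ≠ 0)
  | ghost (p : Path Λ) (hp : G.deg p ≠ 0)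

theorem deg_comp_ne_zero {u v w : Λ} (l : v ⟶ w) (m : u ⟶ v) (hl : G.deg ⟨l⟩ ≠ 0) :
    G.deg ⟨m ≫ l⟩ ≠ 0 := by
  intro h
  apply hl
  have h' : G.d l + G.d m = 0 := by rw [← G.d_comp]; exact h
  funext i
  have hi := congrFun h' i
  simp only [Pi.add_apply, Pi.zero_apply] at hi
  exact (Nat.add_eq_zero_iff.mp hi).1

section KumjianPask

variable (R : Type w) [CommRing R]

/-- The free (non-unital, associative) `R`-algebra on the generators: its basis consists of the
nonempty words in the generators. -/
abbrev FreeAlg : Type (max u v w) := MonoidAlgebra R (FreeSemigroup G.Gen)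

/-- A generator, as an element of the free algebra. -/
noncomputable def gen (x : G.Gen) : G.FreeAlg R := MonoidAlgebra.single (FreeSemigroup.of x) 1

/-- The generator `p_v` of the free algebra. -/
noncomputable abbrev fp (v : Λ) : G.FreeAlg R := G.gen R (.vertex v)

/-- The generator `s_λ` of the free algebra. -/
noncomputable abbrev fs (p : Path Λ) (hp : G.deg p ≠ 0) : G.FreeAlg R := G.gen R (.path p hp)

/-- The generator `s_{λ*}` of the free algebra. -/
noncomputable abbrev ft (p : Path Λ) (hp : G.deg p ≠ 0) : G.FreeAlg R := G.gen R (.ghost p hp)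

/-- The defining relations (KP1)-(KP4) of the Kumjian-Pask algebra. -/
inductive Rel : G.FreeAlg R → G.FreeAlg R → Prop
  -- (KP1): the `p_v` are mutually orthogonal idempotents
  | idem (v : Λ) : Rel (G.fp R v * G.fp R v) (G.fp R v)
  | orth (v w : Λ) (h : v ≠ w) : Rel (G.fp R v * G.fp R w) 0
  -- (KP2): compatibility with composition, range and source
  | comp {u v w : Λ} (l : v ⟶ w) (m : u ⟶ v) (hl : G.deg ⟨l⟩ ≠ 0) (hm : G.deg ⟨m⟩ ≠ 0) :
      Rel (G.fs R ⟨l⟩ hl * G.fs R ⟨m⟩ hm) (G.fs R ⟨m ≫ l⟩ (G.deg_comp_ne_zero l m hl))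
  | ghost_comp {u v w : Λ} (l : v ⟶ w) (m : u ⟶ v) (hl : G.deg ⟨l⟩ ≠ 0)
      (hm : G.deg ⟨m⟩ ≠ 0) :
      Rel (G.ft R ⟨m⟩ hm * G.ft R ⟨l⟩ hl) (G.ft R ⟨m ≫ l⟩ (G.deg_comp_ne_zero l m hl))
  | rng_path (p : Path Λ) (hp : G.deg p ≠ 0) :
      Rel (G.fp R p.rng * G.fs R p hp) (G.fs R p hp)
  | path_src (p : Path Λ) (hp : G.deg p ≠ 0) :
      Rel (G.fs R p hp * G.fp R p.src) (G.fs R p hp)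
  | src_ghost (p : Path Λ) (hp : G.deg p ≠ 0) :
      Rel (G.fp R p.src * G.ft R p hp) (G.ft R p hp)
  | ghost_rng (p : Path Λ) (hp : G.deg p ≠ 0) :
      Rel (G.ft R p hp * G.fp R p.rng) (G.ft R p hp)
  -- (KP3): `s_{λ*} s_μ = δ_{λ,μ} p_{s(λ)}` if `d(λ) = d(μ) ≠ 0`
  | ghost_path_self (p : Path Λ) (hp : G.deg p ≠ 0) :
      Rel (G.ft R p hp * G.fs R p hp) (G.fp R p.src)
  | ghost_path_ne (p q : Path Λ) (hp : G.deg p ≠ 0) (hq : G.deg q ≠ 0)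
      (hd : G.deg p = G.deg q) (hne : p ≠ q) :
      Rel (G.ft R p hp * G.fs R q hq) 0
  -- (KP4): `p_v` is the sum of the `s_λ s_{λ*}` over `λ` in the (finite) set `vΛ^n`, `n ≠ 0`
  | sum (v : Λ) (n : Fin k → ℕ) (hn : n ≠ 0) [Fintype (G.Into v n)] :
      Rel (G.fp R v)
        (∑ p : G.Into v n, G.fs R p.1 (fun h => hn (p.2.2.symm.trans h)) *
          G.ft R p.1 (fun h => hn (p.2.2.symm.trans h)))

/-- The smallest `R`-algebra congruence on the free algebra that contains the relations
(KP1)-(KP4). -/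
inductive CongRel : G.FreeAlg R → G.FreeAlg R → Prop
  | of {a b : G.FreeAlg R} : G.Rel R a b → CongRel a b
  | refl (a : G.FreeAlg R) : CongRel a a
  | symm {a b : G.FreeAlg R} : CongRel a b → CongRel b a
  | trans {a b c : G.FreeAlg R} : CongRel a b → CongRel b c → CongRel a c
  | add {a b a' b' : G.FreeAlg R} : CongRel a b → CongRel a' b' → CongRel (a + a') (b + b')
  | mul {a b a' b' : G.FreeAlg R} : CongRel a b → CongRel a' b' → CongRel (a * a') (b * b')
  | smul (r : R) {a b : G.FreeAlg R} : CongRel a b → CongRel (r • a) (r • b)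

/-- `CongRel` as a bundled ring congruence. -/
noncomputable def con : RingCon (G.FreeAlg R) where
  r := G.CongRel R
  iseqv := ⟨CongRel.refl, CongRel.symm, CongRel.trans⟩
  add' := CongRel.add
  mul' := CongRel.mul

/-- The Kumjian-Pask algebra `KP_R(Λ)`: the universal (in general non-unital) associative
`R`-algebra generated by a Kumjian-Pask `Λ`-family, that is, the quotient of the free algebra
on the vertices, paths and ghost paths by the relations (KP1)-(KP4). -/
noncomputable def KumjianPask : Type (max u v w) := (G.con R).Quotient

noncomputable instance : NonUnitalRing (G.KumjianPask R) :=
  inferInstanceAs (NonUnitalRing (G.con R).Quotient)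

noncomputable instance : SMul R (G.KumjianPask R) where
  smul r := Quotient.map (sa := (G.con R).toSetoid) (sb := (G.con R).toSetoid)
    (fun a => r • a) (fun _ _ h => CongRel.smul r h)

/-- The quotient map from the free algebra. -/
noncomputable def toKP (a : G.FreeAlg R) : G.KumjianPask R := (a : (G.con R).Quotient)

noncomputable instance : Module R (G.KumjianPask R) where
  one_smul := by
    rintro ⟨a⟩
    exact congrArg (G.toKP R) (one_smul R a)
  mul_smul := by
    rintro r s ⟨a⟩
    exact congrArg (G.toKP R) (mul_smul r s a)
  smul_zero r := congrArg (G.toKP R) (smul_zero r)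
  smul_add := by
    rintro r ⟨a⟩ ⟨b⟩
    exact congrArg (G.toKP R) (smul_add r a b)
  add_smul := by
    rintro r s ⟨a⟩
    exact congrArg (G.toKP R) (add_smul r s a)
  zero_smul := by
    rintro ⟨a⟩
    exact congrArg (G.toKP R) (zero_smul R a)

instance : IsScalarTower R (G.KumjianPask R) (G.KumjianPask R) where
  smul_assoc := by
    rintro r ⟨a⟩ ⟨b⟩
    exact congrArg (G.toKP R) (smul_mul_assoc r a b)

instance : SMulCommClass R (G.KumjianPask R) (G.KumjianPask R) where
  smul_comm := by
    rintro r ⟨a⟩ ⟨b⟩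
    exact congrArg (G.toKP R) (mul_smul_comm r a b).symm

end KumjianPask

end KGraph

/-! The products `s_f s_{g*}` span the algebra, so finite sums of vertex projections are local
units. With finitely many vertices the sum of all projections is an identity; with infinitely many,
every element is annihilated by some `p_w`.

For a central `a`, the vertices `v` with `p_v a = 0` form a hereditary and saturated set, which by
cofinality is empty or everything (`Cofinal.eq_zero_of_central`). This settles the infinite case at
once.

In the finite case, centrality gives `s_{f*} a s_f = p_{s(f)} a` for every path `f`. Aperiodicity
supplies an `f` for which the left side is a multiple `r p_{s(f)}` (`Aperiodic.exists_compression`):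
terms `s_α s_{β*}` with `d(α) ≠ d(β)` vanish under compression, and the others become `0` or
`p_{s(f)}`. Thus `a - r 1` is central and annihilated by a vertex projection, hence zero. Linear
independence of the spanning elements is never needed. -/

namespace KGraph

/-! ### Unique factorization of paths -/

section Factorization

variable {k : ℕ} {Λ : Type u} [Category.{v} Λ] (G : KGraph k Λ)

theorem exists_comp_eq {u v : Λ} (f : u ⟶ v) (m n : Fin k → ℕ) (h : G.d f = m + n) :
    ∃ (x : Λ) (a : x ⟶ v) (b : u ⟶ x), G.d a = m ∧ G.d b = n ∧ b ≫ a = f := by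
  obtain ⟨⟨x, a, b⟩, hp, -⟩ := G.factorization f m n h
  exact ⟨x, a, b, hp⟩

theorem exists_comp_eq_of_le {u v : Λ} (f : u ⟶ v) {m : Fin k → ℕ} (h : m ≤ G.d f) :
    ∃ (x : Λ) (a : x ⟶ v) (b : u ⟶ x), G.d a = m ∧ b ≫ a = f := by
  obtain ⟨x, a, b, ha, -, hab⟩ := G.exists_comp_eq f m (G.d f - m) (add_tsub_cancel_of_le h).symm
  exact ⟨x, a, b, ha, hab⟩

/-- Two factorizations of a path whose left factors have the same degree coincide. -/
theorem factors_eq {u v x y : Λ} {a : x ⟶ v} {b : u ⟶ x} {a' : y ⟶ v} {b' : u ⟶ y}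
    (h : b ≫ a = b' ≫ a') (hd : G.d a = G.d a') :
    (⟨x, (a, b)⟩ : Σ x : Λ, (x ⟶ v) × (u ⟶ x)) = ⟨y, (a', b')⟩ := by
  have h1 : G.d b = G.d b' := by
    have := congrArg G.d h
    rw [G.d_comp, G.d_comp, hd] at this
    exact add_left_cancel this
  exact (G.factorization (b ≫ a) _ _ (G.d_comp b a)).unique ⟨rfl, rfl, rfl⟩
    ⟨hd.symm, h1.symm, h.symm⟩

theorem comp_right_cancel (G : KGraph k Λ) {u v w : Λ}
    {b b' : u ⟶ v} {a : v ⟶ w} (h : b ≫ a = b' ≫ a) : b = b' := by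
  cases G.factors_eq h rfl
  rfl

/-- Both `f` and the identity at `v` are left factors of `f` of degree zero, so unique factorization
identifies them. The `eqToHom` form allows degree-zero paths to be eliminated by substitution. -/
theorem exists_eq_eqToHom {u v : Λ} (f : u ⟶ v) (h : G.d f = 0) :
    ∃ e : u = v, f = eqToHom e := by
  have := G.factors_eq (a := f) (b := 𝟙 u) (a' := 𝟙 v) (b' := f) (by simp) (by rw [h, G.d_id])
  cases this
  exact ⟨rfl, rfl⟩

end Factorization

/-! ### Infinite paths and hereditary saturated sets -/

section InfinitePaths

variable {k : ℕ} {Λ : Type u} [Category.{v} Λ] {G : KGraph k Λ}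

/-- A coherent family of initial segments, one of each degree, determines an infinite path. -/
theorem exists_infinitePath_of_initial {w : Λ} (X : (Fin k → ℕ) → Λ) (hd : ∀ m, X m ⟶ w)
    (hdeg : ∀ m, G.d (hd m) = m) (hex : ∀ m n, m ≤ n → ∃ t : X n ⟶ X m, t ≫ hd m = hd n) :
    ∃ x : G.InfinitePath, x.vertex = X := by
  choose t ht using hex
  refine ⟨⟨X, fun {m n} h => t m n h, fun m => ?_, fun {l m n} h h' => ?_, fun {m n} h => ?_⟩, rfl⟩
  · exact G.comp_right_cancel (a := hd m) (by rw [ht, Category.id_comp])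
  · exact G.comp_right_cancel (a := hd l) (by rw [Category.assoc, ht, ht, ht])
  · have := congrArg G.d (ht m n h)
    rw [G.d_comp, hdeg, hdeg] at this
    exact eq_tsub_of_add_eq (by rw [add_comm, this])

/-- If every vertex outside `H` receives a path of degree `(1, …, 1)` from outside `H`, then
every vertex outside the hereditary set `H` is the range of an infinite path outside `H`. -/
theorem exists_infinitePath_notMem {H : Set Λ}
    (hher : ∀ {u v : Λ}, (u ⟶ v) → v ∈ H → u ∈ H)
    (hsat : ∀ v ∉ H, ∃ (u : Λ) (f : u ⟶ v), G.d f = 1 ∧ u ∉ H) {w : Λ} (hw : w ∉ H) :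
    ∃ x : G.InfinitePath, ∀ m, x.vertex m ∉ H := by
  choose src f hf hsrc using hsat
  have hsrc' : ∀ v : {v // v ∉ H}, src v v.2 ∉ H := fun v => hsrc v v.2
  let step : {v // v ∉ H} → {v // v ∉ H} := fun v => ⟨src v v.2, hsrc' v⟩
  let W : ℕ → {v // v ∉ H} := fun j => step^[j] ⟨w, hw⟩
  have hW : ∀ j, (W (j + 1) : Λ) = src (W j) (W j).2 := fun j =>
    congrArg Subtype.val (Function.iterate_succ_apply' step j _)
  have hstep : ∀ j, ∃ g : (W (j + 1) : Λ) ⟶ W j, G.d g = 1 := by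
    intro j
    rw [hW]
    exact ⟨f _ (W j).2, hf _ (W j).2⟩
  choose g hg using hstep
  let C : ∀ j, (W j : Λ) ⟶ w := fun j =>
    @Nat.rec (fun j => (W j : Λ) ⟶ w) (𝟙 w) (fun i c => g i ≫ c) j
  have hC : ∀ j, C (j + 1) = g j ≫ C j := fun _ => rfl
  have hdC : ∀ j, G.d (C j) = fun _ => j := by
    intro j
    induction j with
    | zero => exact G.d_id w
    | succ j ih =>
      rw [hC, G.d_comp, ih, hg]
      rfl
  have hle : ∀ i j, i ≤ j → ∃ t : (W j : Λ) ⟶ W i, t ≫ C i = C j := by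
    intro i j hij
    induction j, hij using Nat.le_induction with
    | base => exact ⟨𝟙 _, Category.id_comp _⟩
    | succ j _ ih =>
      obtain ⟨t, ht⟩ := ih
      exact ⟨g j ≫ t, by rw [Category.assoc, ht, hC]⟩
  -- The composite `C j` has degree `(j, …, j)`. Taking `j = ∑ i, m i` makes it long enough to have
  -- an initial segment of degree `m`, and this choice is monotone in `m`.
  have hN : ∀ m : Fin k → ℕ, m ≤ G.d (C (∑ i, m i)) := by
    intro m i
    rw [hdC]
    exact Finset.single_le_sum (f := m) (fun _ _ => Nat.zero_le _) (Finset.mem_univ i)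
  choose X hd tl hdeg htl using fun m => G.exists_comp_eq_of_le (C (∑ i, m i)) (hN m)
  obtain ⟨x, hx⟩ := exists_infinitePath_of_initial (G := G) X hd hdeg (by
    intro m n hmn
    obtain ⟨t, ht⟩ := hle (∑ i, m i) (∑ i, n i) (Finset.sum_le_sum fun i _ => hmn i)
    obtain ⟨y, a, b, ha, hab⟩ := G.exists_comp_eq_of_le (hd n) (m := m) (by rw [hdeg]; exact hmn)
    -- Both sides factor the longer composite with left factors of degree `m`, so the initial
    -- segment `a` of `hd n` must be `hd m`.
    have key : (tl n ≫ b) ≫ a = (t ≫ tl m) ≫ hd m := by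
      rw [Category.assoc, hab, htl, Category.assoc, htl, ht]
    have := G.factors_eq key (by rw [ha, hdeg])
    obtain ⟨hy, h2⟩ := Sigma.mk.inj_iff.1 this
    subst hy
    obtain ⟨rfl, -⟩ := Prod.mk.inj (eq_of_heq h2)
    exact ⟨b, hab⟩)
  -- The remainder `tl m` runs from `W (∑ i, m i)` to `x(m)`, so if `x(m)` were in `H`, heredity
  -- would put that vertex of the chain in `H`.
  refine ⟨x, fun m hm => (W (∑ i, m i)).2 ?_⟩
  rw [hx] at hm
  exact hher (tl m) hm

/-- In a cofinal `k`-graph, a nonempty hereditary and saturated set contains every vertex. -/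
theorem Cofinal.mem_of_hereditary_saturated (hcof : G.Cofinal) {H : Set Λ}
    (hher : ∀ {u v : Λ}, (u ⟶ v) → v ∈ H → u ∈ H)
    (hsat : ∀ v, (∀ (u : Λ) (f : u ⟶ v), G.d f = 1 → u ∈ H) → v ∈ H) (hne : H.Nonempty)
    (v : Λ) : v ∈ H := by
  by_contra hv
  obtain ⟨x, hx⟩ := exists_infinitePath_notMem (G := G) hher (by
    intro v hv
    by_contra! hcon
    exact hv (hsat v hcon)) hv
  obtain ⟨w, hw⟩ := hne
  obtain ⟨m, ⟨f⟩⟩ := hcof x w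
  exact hx m (hher f hw)

end InfinitePaths

/-! ### Aperiodicity under extension of paths -/

section Separation

variable {k : ℕ} {Λ : Type u} [Category.{v} Λ] (G : KGraph k Λ)

/-- The shifts of `f` by `m` and by `n` have distinct initial segments of some common degree. -/
def Separates {u v : Λ} (m n : Fin k → ℕ) (f : u ⟶ v) : Prop :=
  ∃ (e : Fin k → ℕ) (g h : Path Λ), G.IsSegment f m (m + e) g ∧ G.IsSegment f n (n + e) h ∧ g ≠ h

variable {G}

theorem IsSegment.append {u v w : Λ} {f : u ⟶ v} {p q : Fin k → ℕ} {g : Path Λ}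
    (h : G.IsSegment f p q g) (b : w ⟶ u) : G.IsSegment (b ≫ f) p q g := by
  obtain ⟨a, c, hf, ha, hg⟩ := h
  exact ⟨a, b ≫ c, by rw [Category.assoc, hf], ha, hg⟩

theorem Separates.append {u v w : Λ} {m n : Fin k → ℕ} {f : u ⟶ v} (h : G.Separates m n f)
    (b : w ⟶ u) : G.Separates m n (b ≫ f) := by
  obtain ⟨e, g, h, hg, hh, hne⟩ := h
  exact ⟨e, g, h, hg.append b, hh.append b, hne⟩

/-- If `f = a g b`, refactor `l a = a' c` with `d(a') = p`. Then `l f = a' (c g) b`, so the segment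
at position `p` becomes `c g`, longer by `d(l)`. -/
theorem IsSegment.prepend {u v w : Λ} {f : u ⟶ v} {p e : Fin k → ℕ} {g : Path Λ}
    (h : G.IsSegment f p (p + e) g) (l : v ⟶ w) :
    ∃ (x : Λ) (c : g.rng ⟶ x), G.d c = G.d l ∧
      G.IsSegment (f ≫ l) p (p + (e + G.d l)) ⟨g.hom ≫ c⟩ := by
  obtain ⟨a, b, hf, ha, hg⟩ := h
  obtain ⟨x, a', c, ha', hc, hac⟩ := G.exists_comp_eq (a ≫ l) p (G.d l)
    (by rw [G.d_comp, ha, add_comm])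
  refine ⟨x, c, hc, a', b, ?_, ha', ?_⟩
  · simp only [Category.assoc, hac, ← hf]
  · have hge : G.d g.hom = e := add_left_cancel hg
    simp only [deg, G.d_comp, hc, hge, add_comm e]

/-- The new segments are `c g` and `c' h` with `d(c) = d(c')`, so their equality would force `g =
h`. Their common degree grows by `d(l)`, which is why `Separates` leaves that degree free. -/
theorem Separates.prepend {u v w : Λ} {m n : Fin k → ℕ} {f : u ⟶ v} (h : G.Separates m n f)
    (l : v ⟶ w) : G.Separates m n (f ≫ l) := by
  obtain ⟨e, ⟨g⟩, ⟨h⟩, hg, hh, hne⟩ := h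
  obtain ⟨x, c, hc, hg'⟩ := hg.prepend l
  obtain ⟨y, c', hc', hh'⟩ := hh.prepend l
  refine ⟨_, _, _, hg', hh', fun heq => hne ?_⟩
  simp only at c c' hc hc' heq
  rw [Path.mk.injEq] at heq
  obtain ⟨rfl, rfl, heq⟩ := heq
  cases G.factors_eq (eq_of_heq heq) (hc.trans hc'.symm)
  rfl

theorem Aperiodic.exists_separates (h : G.Aperiodic) (v : Λ) {m n : Fin k → ℕ} (hmn : m ≠ n) :
    ∃ (u : Λ) (f : u ⟶ v), m ⊔ n ≤ G.d f ∧ G.Separates m n f := by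
  obtain ⟨u, f, hf, g, h, hg, hh, hne⟩ := h v m n hmn
  exact ⟨u, f, hf, _, g, h, hg, hh, hne⟩

end Separation

/-! ### Kumjian-Pask relations extended to paths of degree zero -/

section Generators

variable {k : ℕ} {Λ : Type u} [Category.{v} Λ] (G : KGraph k Λ) (R : Type w) [CommRing R]

theorem toKP_eq {a b : G.FreeAlg R} (h : G.Rel R a b) : G.toKP R a = G.toKP R b :=
  (RingCon.eq (G.con R)).2 (CongRel.of h)

theorem toKP_mul (a b : G.FreeAlg R) : G.toKP R (a * b) = G.toKP R a * G.toKP R b := rfl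

theorem toKP_add (a b : G.FreeAlg R) : G.toKP R (a + b) = G.toKP R a + G.toKP R b := rfl

theorem toKP_smul (r : R) (a : G.FreeAlg R) : G.toKP R (r • a) = r • G.toKP R a := rfl

theorem toKP_sum {ι : Type*} (s : Finset ι) (f : ι → G.FreeAlg R) :
    G.toKP R (∑ i ∈ s, f i) = ∑ i ∈ s, G.toKP R (f i) :=
  map_sum (AddMonoidHom.mk' (G.toKP R) (G.toKP_add R)) f s

theorem toKP_surjective : Function.Surjective (G.toKP R) := by
  rintro ⟨a⟩
  exact ⟨a, rfl⟩

/-- The projection `p_v` in the Kumjian-Pask algebra. -/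
noncomputable def proj (v : Λ) : G.KumjianPask R := G.toKP R (G.fp R v)

open Classical in
/-- The element `s_f` of the Kumjian-Pask algebra, with `s_v = p_v` for a vertex `v`. -/
noncomputable def real {u v : Λ} (f : u ⟶ v) : G.KumjianPask R :=
  if h : G.deg ⟨f⟩ = 0 then G.proj R v else G.toKP R (G.fs R ⟨f⟩ h)

open Classical in
/-- The element `s_{f*}` of the Kumjian-Pask algebra, with `s_{v*} = p_v` for a vertex `v`. -/
noncomputable def star {u v : Λ} (f : u ⟶ v) : G.KumjianPask R :=
  if h : G.deg ⟨f⟩ = 0 then G.proj R v else G.toKP R (G.ft R ⟨f⟩ h)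

theorem real_id (v : Λ) : G.real R (𝟙 v) = G.proj R v := dif_pos (G.d_id v)

theorem star_id (v : Λ) : G.star R (𝟙 v) = G.proj R v := dif_pos (G.d_id v)

theorem real_of_ne {u v : Λ} (f : u ⟶ v) (h : G.deg ⟨f⟩ ≠ 0) :
    G.real R f = G.toKP R (G.fs R ⟨f⟩ h) := dif_neg h

theorem star_of_ne {u v : Λ} (f : u ⟶ v) (h : G.deg ⟨f⟩ ≠ 0) :
    G.star R f = G.toKP R (G.ft R ⟨f⟩ h) := dif_neg h

theorem proj_mul_self (v : Λ) : G.proj R v * G.proj R v = G.proj R v :=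
  G.toKP_eq R (.idem v)

theorem proj_mul_of_ne {v w : Λ} (h : v ≠ w) : G.proj R v * G.proj R w = 0 :=
  G.toKP_eq R (.orth v w h)

theorem proj_mul_real {u v : Λ} (f : u ⟶ v) : G.proj R v * G.real R f = G.real R f := by
  by_cases h : G.deg ⟨f⟩ = 0
  · obtain ⟨rfl, rfl⟩ := G.exists_eq_eqToHom f h
    rw [eqToHom_refl, real_id, proj_mul_self]
  · rw [G.real_of_ne R f h]
    exact G.toKP_eq R (.rng_path ⟨f⟩ h)

theorem real_mul_proj {u v : Λ} (f : u ⟶ v) : G.real R f * G.proj R u = G.real R f := by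
  by_cases h : G.deg ⟨f⟩ = 0
  · obtain ⟨rfl, rfl⟩ := G.exists_eq_eqToHom f h
    rw [eqToHom_refl, real_id, proj_mul_self]
  · rw [G.real_of_ne R f h]
    exact G.toKP_eq R (.path_src ⟨f⟩ h)

theorem proj_mul_star {u v : Λ} (f : u ⟶ v) : G.proj R u * G.star R f = G.star R f := by
  by_cases h : G.deg ⟨f⟩ = 0
  · obtain ⟨rfl, rfl⟩ := G.exists_eq_eqToHom f h
    rw [eqToHom_refl, star_id, proj_mul_self]
  · rw [G.star_of_ne R f h]
    exact G.toKP_eq R (.src_ghost ⟨f⟩ h)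

theorem star_mul_proj {u v : Λ} (f : u ⟶ v) : G.star R f * G.proj R v = G.star R f := by
  by_cases h : G.deg ⟨f⟩ = 0
  · obtain ⟨rfl, rfl⟩ := G.exists_eq_eqToHom f h
    rw [eqToHom_refl, star_id, proj_mul_self]
  · rw [G.star_of_ne R f h]
    exact G.toKP_eq R (.ghost_rng ⟨f⟩ h)

theorem real_comp {u v w : Λ} (m : u ⟶ v) (l : v ⟶ w) :
    G.real R (m ≫ l) = G.real R l * G.real R m := by
  by_cases hl : G.deg ⟨l⟩ = 0
  · obtain ⟨rfl, rfl⟩ := G.exists_eq_eqToHom l hl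
    rw [eqToHom_refl, real_id, Category.comp_id, proj_mul_real]
  by_cases hm : G.deg ⟨m⟩ = 0
  · obtain ⟨rfl, rfl⟩ := G.exists_eq_eqToHom m hm
    rw [eqToHom_refl, real_id, Category.id_comp, real_mul_proj]
  rw [G.real_of_ne R _ (G.deg_comp_ne_zero l m hl), G.real_of_ne R l hl, G.real_of_ne R m hm]
  exact (G.toKP_eq R (.comp l m hl hm)).symm

theorem star_comp {u v w : Λ} (m : u ⟶ v) (l : v ⟶ w) :
    G.star R (m ≫ l) = G.star R m * G.star R l := by
  by_cases hl : G.deg ⟨l⟩ = 0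
  · obtain ⟨rfl, rfl⟩ := G.exists_eq_eqToHom l hl
    rw [eqToHom_refl, star_id, Category.comp_id, star_mul_proj]
  by_cases hm : G.deg ⟨m⟩ = 0
  · obtain ⟨rfl, rfl⟩ := G.exists_eq_eqToHom m hm
    rw [eqToHom_refl, star_id, Category.id_comp, proj_mul_star]
  rw [G.star_of_ne R _ (G.deg_comp_ne_zero l m hl), G.star_of_ne R l hl, G.star_of_ne R m hm]
  exact (G.toKP_eq R (.ghost_comp l m hl hm)).symm

theorem star_mul_real_self {u v : Λ} (f : u ⟶ v) : G.star R f * G.real R f = G.proj R u := by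
  by_cases h : G.deg ⟨f⟩ = 0
  · obtain ⟨rfl, rfl⟩ := G.exists_eq_eqToHom f h
    rw [eqToHom_refl, star_id, real_id, proj_mul_self]
  · rw [G.star_of_ne R f h, G.real_of_ne R f h]
    exact G.toKP_eq R (.ghost_path_self ⟨f⟩ h)

theorem star_mul_real_of_ne {u v u' v' : Λ} (f : u ⟶ v) (g : u' ⟶ v') (hd : G.d f = G.d g)
    (hne : Path.mk f ≠ Path.mk g) : G.star R f * G.real R g = 0 := by
  by_cases h : G.deg ⟨f⟩ = 0
  · obtain ⟨rfl, rfl⟩ := G.exists_eq_eqToHom f h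
    obtain ⟨rfl, rfl⟩ := G.exists_eq_eqToHom g (hd.symm.trans h)
    rw [eqToHom_refl, eqToHom_refl, star_id, real_id]
    exact G.proj_mul_of_ne R fun h => hne (by subst h; rfl)
  · have h' : G.deg ⟨g⟩ ≠ 0 := fun h' => h (hd.trans h')
    rw [G.star_of_ne R f h, G.real_of_ne R g h']
    exact G.toKP_eq R (.ghost_path_ne ⟨f⟩ ⟨g⟩ h h' hd hne)

theorem proj_eq_sum (v : Λ) (n : Fin k → ℕ) [Fintype (G.Into v n)] :
    G.proj R v = ∑ p : G.Into v n, G.real R p.1.hom * G.star R p.1.hom := by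
  by_cases hn : n = 0
  · subst hn
    have h0 : ∀ p : G.Into v 0, p = ⟨⟨𝟙 v⟩, rfl, G.d_id v⟩ := by
      rintro ⟨⟨f⟩, hv, h⟩
      refine Subtype.ext ?_
      obtain ⟨rfl, rfl⟩ := G.exists_eq_eqToHom f h
      obtain rfl : _ = v := hv
      rfl
    rw [Fintype.sum_eq_single _ fun p hp => (hp (h0 p)).elim, real_id, star_id, proj_mul_self]
  · have := G.toKP_eq R (.sum v n hn)
    rw [proj, this, toKP_sum]
    refine Finset.sum_congr rfl fun p _ => ?_
    have hp : G.deg p.1 ≠ 0 := fun h => hn (p.2.2.symm.trans h)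
    rw [toKP_mul, G.real_of_ne R p.1.hom hp, G.star_of_ne R p.1.hom hp]

end Generators

/-! ### Spanning by the products of a real and a ghost path -/

section Span

variable {k : ℕ} {Λ : Type u} [Category.{v} Λ] (G : KGraph k Λ) (R : Type w) [CommRing R]

/-- The submodule spanned by the elements `s_f s_{g*}`. -/
noncomputable def realStarSpan : Submodule R (G.KumjianPask R) :=
  Submodule.span R {a | ∃ (u v w : Λ) (f : u ⟶ v) (g : u ⟶ w), a = G.real R f * G.star R g}

variable {G}

theorem real_mul_star_mem {u v w : Λ} (f : u ⟶ v) (g : u ⟶ w) :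
    G.real R f * G.star R g ∈ G.realStarSpan R :=
  Submodule.subset_span ⟨u, v, w, f, g, rfl⟩

theorem real_mem {u v : Λ} (f : u ⟶ v) : G.real R f ∈ G.realStarSpan R := by
  rw [← real_mul_proj, ← star_id]
  exact real_mul_star_mem R _ _

theorem star_mem {u v : Λ} (f : u ⟶ v) : G.star R f ∈ G.realStarSpan R := by
  rw [← proj_mul_star, ← real_id]
  exact real_mul_star_mem R _ _

theorem real_mul_real_mul_star_mem {u v x y z : Λ} (h : x ⟶ y) (f : u ⟶ v) (g : u ⟶ z) :
    G.real R h * (G.real R f * G.star R g) ∈ G.realStarSpan R := by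
  by_cases hxv : x = v
  · subst hxv
    rw [← mul_assoc, ← real_comp]
    exact real_mul_star_mem R _ _
  · rw [← real_mul_proj, ← G.proj_mul_real R f, mul_assoc, ← mul_assoc (G.proj R x),
      ← mul_assoc (G.proj R x), G.proj_mul_of_ne R hxv, zero_mul, zero_mul, mul_zero]
    exact zero_mem _

theorem real_mul_star_mul_star_mem {u v x y z : Λ} (f : u ⟶ v) (g : u ⟶ z) (h : x ⟶ y) :
    G.real R f * G.star R g * G.star R h ∈ G.realStarSpan R := by
  by_cases hxz : x = z
  · subst hxz
    rw [mul_assoc, ← star_comp]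
    exact real_mul_star_mem R _ _
  · rw [← G.proj_mul_star R h, ← G.star_mul_proj R g, mul_assoc, mul_assoc (G.star R g),
      ← mul_assoc (G.proj R z), G.proj_mul_of_ne R (Ne.symm hxz), zero_mul, mul_zero, mul_zero]
    exact zero_mem _

/-- `s_{g*} s_f` is a real path or zero if `d(g) ≤ d(f)`. -/
theorem star_mul_real_of_le {u v x y : Λ} (g : x ⟶ y) (f : u ⟶ v) (h : G.d g ≤ G.d f) :
    G.star R g * G.real R f = 0 ∨ ∃ t : u ⟶ x, G.star R g * G.real R f = G.real R t := by
  obtain ⟨z, a, b, ha, rfl⟩ := G.exists_comp_eq_of_le f h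
  by_cases hag : Path.mk g = Path.mk a
  · rw [Path.mk.injEq] at hag
    obtain ⟨rfl, rfl, hag⟩ := hag
    obtain rfl := eq_of_heq hag
    exact .inr ⟨b, by rw [real_comp, ← mul_assoc, star_mul_real_self, proj_mul_real]⟩
  · exact .inl (by rw [real_comp, ← mul_assoc, G.star_mul_real_of_ne R g a ha.symm hag, zero_mul])

/-- `s_{f*} s_g` is a ghost path or zero if `d(g) ≤ d(f)`. -/
theorem star_mul_real_of_ge {u v x y : Λ} (g : x ⟶ y) (f : u ⟶ v) (h : G.d g ≤ G.d f) :
    G.star R f * G.real R g = 0 ∨ ∃ t : u ⟶ x, G.star R f * G.real R g = G.star R t := by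
  obtain ⟨z, a, b, ha, rfl⟩ := G.exists_comp_eq_of_le f h
  by_cases hag : Path.mk a = Path.mk g
  · rw [Path.mk.injEq] at hag
    obtain ⟨rfl, rfl, hag⟩ := hag
    obtain rfl := eq_of_heq hag
    exact .inr ⟨b, by rw [star_comp, mul_assoc, star_mul_real_self, star_mul_proj]⟩
  · exact .inl (by rw [star_comp, mul_assoc, G.star_mul_real_of_ne R a g ha hag, mul_zero])

variable {R} in
theorem real_mul_mem {x y : Λ} (h : x ⟶ y) {a : G.KumjianPask R} (ha : a ∈ G.realStarSpan R) :
    G.real R h * a ∈ G.realStarSpan R := by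
  induction ha using Submodule.span_induction with
  | mem a ha =>
    obtain ⟨u, v, w, f, g, rfl⟩ := ha
    exact real_mul_real_mul_star_mem R h f g
  | zero => rw [mul_zero]; exact zero_mem _
  | add a b _ _ ha hb => rw [mul_add]; exact add_mem ha hb
  | smul r a _ ha => rw [mul_smul_comm]; exact Submodule.smul_mem _ r ha

variable {R} in
theorem mul_star_mem {x y : Λ} (h : x ⟶ y) {a : G.KumjianPask R} (ha : a ∈ G.realStarSpan R) :
    a * G.star R h ∈ G.realStarSpan R := by
  induction ha using Submodule.span_induction with
  | mem a ha =>
    obtain ⟨u, v, w, f, g, rfl⟩ := ha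
    exact real_mul_star_mul_star_mem R f g h
  | zero => rw [zero_mul]; exact zero_mem _
  | add a b _ _ ha hb => rw [add_mul]; exact add_mem ha hb
  | smul r a _ ha => rw [smul_mul_assoc]; exact Submodule.smul_mem _ r ha

/-- Insert `p_v = ∑ s_p s_{p*}` over paths of degree `d(g) ∨ d(f)`. Each `p` is at least as long as
both paths, so `s_{g*} s_p` is real or zero and `s_{p*} s_f` is ghost or zero. -/
theorem star_mul_real_mem (hrow : G.RowFinite) {u v x y : Λ} (g : x ⟶ y) (f : u ⟶ v) :
    G.star R g * G.real R f ∈ G.realStarSpan R := by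
  let n := G.d g ⊔ G.d f
  have := hrow v n
  have := Fintype.ofFinite (G.Into v n)
  rw [← G.proj_mul_real R f, G.proj_eq_sum R v n, Finset.sum_mul, Finset.mul_sum]
  refine Submodule.sum_mem _ fun p _ => ?_
  have hp : G.d p.1.hom = n := p.2.2
  rw [mul_assoc, ← mul_assoc]
  rcases star_mul_real_of_le R g p.1.hom (le_sup_left.trans hp.ge) with h | ⟨t, h⟩
  · rw [h, zero_mul]
    exact zero_mem _
  rcases star_mul_real_of_ge R f p.1.hom (le_sup_right.trans hp.ge) with h' | ⟨t', h'⟩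
  · rw [h', mul_zero]
    exact zero_mem _
  rw [h, h']
  exact real_mul_star_mem R t t'

variable {R} in
theorem mul_mem_realStarSpan (hrow : G.RowFinite) {a b : G.KumjianPask R}
    (ha : a ∈ G.realStarSpan R) (hb : b ∈ G.realStarSpan R) : a * b ∈ G.realStarSpan R := by
  induction ha, hb using Submodule.span_induction₂ with
  | mem_mem a b ha hb =>
    obtain ⟨u, v, w, f, g, rfl⟩ := ha
    obtain ⟨u', v', w', f', g', rfl⟩ := hb
    rw [mul_assoc, ← mul_assoc (G.star R g)]
    exact real_mul_mem f (mul_star_mem g' (star_mul_real_mem R hrow g f'))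
  | zero_left => rw [zero_mul]; exact zero_mem _
  | zero_right => rw [mul_zero]; exact zero_mem _
  | add_left _ _ _ _ _ _ h h' => rw [add_mul]; exact add_mem h h'
  | add_right _ _ _ _ _ _ h h' => rw [mul_add]; exact add_mem h h'
  | smul_left r _ _ _ _ h => rw [smul_mul_assoc]; exact Submodule.smul_mem _ r h
  | smul_right r _ _ _ _ h => rw [mul_smul_comm]; exact Submodule.smul_mem _ r h

theorem toKP_gen_mem (x : G.Gen) : G.toKP R (G.gen R x) ∈ G.realStarSpan R := by
  cases x with
  | vertex v =>
    have := real_mem (G := G) R (𝟙 v)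
    rwa [real_id] at this
  | path p hp => exact G.real_of_ne R p.hom hp ▸ real_mem R p.hom
  | ghost p hp => exact G.star_of_ne R p.hom hp ▸ star_mem R p.hom

/-- The elements `s_f s_{g*}` span the Kumjian-Pask algebra. -/
theorem mem_realStarSpan (hrow : G.RowFinite) (a : G.KumjianPask R) : a ∈ G.realStarSpan R := by
  obtain ⟨a, rfl⟩ := G.toKP_surjective R a
  have hword : ∀ x : FreeSemigroup G.Gen,
      G.toKP R (MonoidAlgebra.single x 1) ∈ G.realStarSpan R := by
    intro x
    induction x using FreeSemigroup.recOnMul with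
    | ih1 x => exact toKP_gen_mem R x
    | ih2 x y hx hy =>
      have : (MonoidAlgebra.single (FreeSemigroup.of x * y) 1 : G.FreeAlg R) =
          MonoidAlgebra.single (FreeSemigroup.of x) 1 * MonoidAlgebra.single y 1 := by
        rw [MonoidAlgebra.single_mul_single, one_mul]
      rw [this, toKP_mul]
      exact mul_mem_realStarSpan hrow hx hy
  induction a using MonoidAlgebra.induction_linear with
  | zero => exact zero_mem _
  | add a b ha hb => rw [toKP_add]; exact add_mem ha hb
  | single x r =>
    have : (MonoidAlgebra.single x r : G.FreeAlg R) = r • MonoidAlgebra.single x 1 := by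
      rw [MonoidAlgebra.smul_single, smul_eq_mul, mul_one]
    rw [this, toKP_smul]
    exact Submodule.smul_mem _ r (hword x)

end Span

/-! ### Local units, central elements and compression -/

section Center

variable {k : ℕ} {Λ : Type u} [Category.{v} Λ] {G : KGraph k Λ} {R : Type w} [CommRing R]

open Classical in
/-- Sums of the projections over large finite sets of vertices are local units. -/
theorem exists_finset_sum_proj_mul (hrow : G.RowFinite) (a : G.KumjianPask R) :
    ∃ F : Finset Λ, ∀ F', F ⊆ F' → (∑ v ∈ F', G.proj R v) * a = a ∧
      a * (∑ v ∈ F', G.proj R v) = a := by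
  induction mem_realStarSpan R hrow a using Submodule.span_induction with
  | mem a ha =>
    obtain ⟨u, v, w, f, g, rfl⟩ := ha
    refine ⟨{v, w}, fun F' hF' => ⟨?_, ?_⟩⟩
    · rw [← G.proj_mul_real R f, ← mul_assoc, ← mul_assoc, Finset.sum_mul,
        Finset.sum_eq_single v, proj_mul_self]
      · exact fun x _ hx => G.proj_mul_of_ne R hx
      · exact fun h => (h (hF' (by simp))).elim
    · rw [← G.star_mul_proj R g, mul_assoc, mul_assoc, Finset.mul_sum,
        Finset.sum_eq_single w, proj_mul_self]
      · exact fun x _ hx => G.proj_mul_of_ne R hx.symm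
      · exact fun h => (h (hF' (by simp))).elim
  | zero => exact ⟨∅, fun F' _ => ⟨mul_zero _, zero_mul _⟩⟩
  | add a b _ _ ha hb =>
    obtain ⟨F, hF⟩ := ha
    obtain ⟨F₁, hF₁⟩ := hb
    refine ⟨F ∪ F₁, fun F' hF' => ?_⟩
    obtain ⟨h1, h2⟩ := hF F' (Finset.union_subset_left hF')
    obtain ⟨h3, h4⟩ := hF₁ F' (Finset.union_subset_right hF')
    exact ⟨by rw [mul_add, h1, h3], by rw [add_mul, h2, h4]⟩
  | smul r a _ ha =>
    obtain ⟨F, hF⟩ := ha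
    refine ⟨F, fun F' hF' => ?_⟩
    obtain ⟨h1, h2⟩ := hF F' hF'
    exact ⟨by rw [mul_smul_comm, h1], by rw [smul_mul_assoc, h2]⟩

theorem eq_zero_of_proj_mul_eq_zero (hrow : G.RowFinite) {a : G.KumjianPask R}
    (h : ∀ v, G.proj R v * a = 0) : a = 0 := by
  obtain ⟨F, hF⟩ := exists_finset_sum_proj_mul hrow a
  rw [← (hF F subset_rfl).1, Finset.sum_mul, Finset.sum_eq_zero fun v _ => h v]

theorem star_mul_mul_real {a : G.KumjianPask R} (ha : ∀ b, b * a = a * b) {u v : Λ}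
    (f : u ⟶ v) : G.star R f * a * G.real R f = G.proj R u * a := by
  rw [mul_assoc, ← ha, ← mul_assoc, star_mul_real_self]

/-- In the cofinal case, a central element that is annihilated by a vertex projection is zero. -/
theorem Cofinal.eq_zero_of_central (hcof : G.Cofinal) (hrow : G.RowFinite) {a : G.KumjianPask R}
    (ha : ∀ b, b * a = a * b) {w : Λ} (hw : G.proj R w * a = 0) : a = 0 := by
  refine eq_zero_of_proj_mul_eq_zero hrow fun v => ?_
  refine hcof.mem_of_hereditary_saturated (H := {v | G.proj R v * a = 0}) ?_ ?_ ⟨w, hw⟩ v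
  -- Heredity: `p_u a = s_{f*} a s_f = s_{f*} (p_v a) s_f`.
  · intro u v f (hv : G.proj R v * a = 0)
    change G.proj R u * a = 0
    rw [← star_mul_mul_real ha f, ← G.star_mul_proj R f, mul_assoc (G.star R f), hv, mul_zero,
      zero_mul]
  -- Saturation: `p_v a = ∑ s_f s_{f*} a = ∑ s_f (p_{s(f)} a) s_{f*}` over paths `f` of degree `(1,
  -- …, 1)`.
  · intro v hv
    change G.proj R v * a = 0
    have := hrow v 1
    have := Fintype.ofFinite (G.Into v 1)
    rw [G.proj_eq_sum R v 1, Finset.sum_mul]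
    refine Finset.sum_eq_zero ?_
    rintro ⟨⟨f⟩, rfl, hf⟩ -
    have := hv _ f hf
    rw [mul_assoc, ha, ← mul_assoc, ← G.real_mul_proj R f, mul_assoc (G.real R f), this, mul_zero,
      zero_mul]

/-- The tails `b` and `b'` begin with distinct paths `g` and `h` of equal degree, so the product
contains the factor `s_{g*} s_h = 0`. -/
theorem star_mul_real_eq_zero_of_separates {u v x y : Λ} {m n : Fin k → ℕ} {a : x ⟶ v} {b : u ⟶ x}
    {a' : y ⟶ v} {b' : u ⟶ y} (hf : b ≫ a = b' ≫ a') (ha : G.d a = m) (ha' : G.d a' = n)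
    (h : G.Separates m n (b ≫ a)) : G.star R b * G.real R b' = 0 := by
  obtain ⟨e, ⟨g⟩, ⟨h⟩, ⟨c, t, hc, hcm, hce⟩, ⟨c', t', hc', hcm', hce'⟩, hne⟩ := h
  simp only at c t c' t' hc hc'
  rw [← Category.assoc] at hc hc'
  cases G.factors_eq hc (hcm.trans ha.symm)
  cases G.factors_eq (hc'.trans hf) (hcm'.trans ha'.symm)
  have hd : G.d g = G.d h := (add_left_cancel hce).trans (add_left_cancel hce').symm
  rw [star_comp, real_comp, mul_assoc, ← mul_assoc (G.star R g),
    G.star_mul_real_of_ne R g h hd hne, zero_mul, mul_zero]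

/-- The product vanishes unless `α` and `β` are both initial segments of `f`. Then it is `s_{b*}
s_{b'}` for the two tails: a projection if the degrees agree, since the tails coincide, and zero by
separation otherwise. -/
theorem exists_star_mul_mul_real_eq_smul {u v w x y : Λ} (α : u ⟶ v) (β : u ⟶ w) (f : x ⟶ y)
    (hα : G.d α ≤ G.d f) (hβ : G.d β ≤ G.d f)
    (hsep : G.d α ≠ G.d β → G.Separates (G.d α) (G.d β) f) :
    ∃ r : R, G.star R f * (G.real R α * G.star R β) * G.real R f = r • G.proj R x := by
  obtain ⟨z, a, b, ha, rfl⟩ := G.exists_comp_eq_of_le f hα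
  obtain ⟨z', a', b', ha', hf⟩ := G.exists_comp_eq_of_le _ hβ
  have key : G.star R (b ≫ a) * (G.real R α * G.star R β) * G.real R (b ≫ a) =
      G.star R b * (G.star R a * G.real R α) * ((G.star R β * G.real R a') * G.real R b') := by
    nth_rw 2 [← hf]
    rw [star_comp, real_comp]
    simp only [mul_assoc]
  rw [key]
  by_cases h1 : Path.mk a = Path.mk α
  swap
  · exact ⟨0, by rw [G.star_mul_real_of_ne R a α ha h1, mul_zero, zero_mul, zero_smul]⟩
  by_cases h2 : Path.mk β = Path.mk a'
  swap
  · exact ⟨0, by rw [G.star_mul_real_of_ne R β a' ha'.symm h2, zero_mul, mul_zero, zero_smul]⟩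
  rw [Path.mk.injEq] at h1 h2
  obtain ⟨rfl, rfl, h1⟩ := h1
  obtain rfl := eq_of_heq h1
  obtain ⟨rfl, rfl, h2⟩ := h2
  obtain rfl := eq_of_heq h2
  rw [star_mul_real_self, star_mul_real_self, star_mul_proj, proj_mul_real]
  by_cases hd : G.d a = G.d β
  · cases G.factors_eq hf hd.symm
    exact ⟨1, by rw [star_mul_real_self, one_smul]⟩
  · exact ⟨0, by rw [star_mul_real_eq_zero_of_separates hf.symm rfl rfl (hsep hd), zero_smul]⟩

/-- In the aperiodic case, compressing by suitable paths maps any given element to multiples of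
vertex projections. -/
theorem Aperiodic.exists_compression (hap : G.Aperiodic) (hrow : G.RowFinite)
    (hns : G.NoSources) (a : G.KumjianPask R) (v : Λ) :
    ∃ (u : Λ) (f : u ⟶ v), ∀ (x y : Λ) (b : x ⟶ u) (l : v ⟶ y),
      ∃ r : R, G.star R (b ≫ f ≫ l) * a * G.real R (b ≫ f ≫ l) = r • G.proj R x := by
  induction mem_realStarSpan R hrow a using Submodule.span_induction generalizing v with
  | mem a ha =>
    obtain ⟨u, _, _, α, β, rfl⟩ := ha
    have : ∃ (u : Λ) (f : u ⟶ v), G.d α ⊔ G.d β ≤ G.d f ∧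
        (G.d α ≠ G.d β → G.Separates (G.d α) (G.d β) f) := by
      -- For equal degrees only the length of `f` matters, and the absence of sources provides it.
      by_cases hd : G.d α = G.d β
      · obtain ⟨⟨⟨f⟩, rfl, hf⟩⟩ := hns v (G.d α ⊔ G.d β)
        exact ⟨_, f, hf.ge, fun h => (h hd).elim⟩
      · obtain ⟨u, f, hf, hs⟩ := hap.exists_separates v hd
        exact ⟨u, f, hf, fun _ => hs⟩
    obtain ⟨u, f, hf, hs⟩ := this
    refine ⟨u, f, fun x y b l => ?_⟩
    have hle : G.d f ≤ G.d (b ≫ f ≫ l) := by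
      rw [G.d_comp, G.d_comp]
      exact le_add_right le_add_self
    exact exists_star_mul_mul_real_eq_smul α β _ (le_sup_left.trans (hf.trans hle))
      (le_sup_right.trans (hf.trans hle)) fun h => ((hs h).prepend l).append b
  | zero =>
    exact ⟨v, 𝟙 v, fun x y b l => ⟨0, by rw [mul_zero, zero_mul, zero_smul]⟩⟩
  | add a b _ _ ha hb =>
    -- The path for the second summand is chosen at the source of the first, and their composite
    -- serves both: it extends `f` by `f'` at the source end and `f'` by `f` at the range end.
    -- Quantifying over `b` and `l` makes this possible.
    obtain ⟨u, f, hf⟩ := ha v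
    obtain ⟨u', f', hf'⟩ := hb u
    refine ⟨u', f' ≫ f, fun x y b l => ?_⟩
    obtain ⟨r, hr⟩ := hf x y (b ≫ f') l
    obtain ⟨r', hr'⟩ := hf' x y b (f ≫ l)
    simp only [Category.assoc] at hr hr' ⊢
    exact ⟨r + r', by rw [mul_add, add_mul, hr, hr', add_smul]⟩
  | smul r a _ ha =>
    obtain ⟨u, f, hf⟩ := ha v
    refine ⟨u, f, fun x y b l => ?_⟩
    obtain ⟨r', hr'⟩ := hf x y b l
    exact ⟨r * r', by rw [mul_smul_comm, smul_mul_assoc, hr', mul_smul]⟩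

/-- In the aperiodic case, a central element is a scalar at some vertex. -/
theorem Aperiodic.exists_proj_mul_eq_smul (hap : G.Aperiodic) (hrow : G.RowFinite)
    (hns : G.NoSources) {a : G.KumjianPask R} (ha : ∀ b, b * a = a * b) (v : Λ) :
    ∃ (w : Λ) (r : R), G.proj R w * a = r • G.proj R w := by
  obtain ⟨u, f, hf⟩ := hap.exists_compression hrow hns a v
  obtain ⟨r, hr⟩ := hf u v (𝟙 u) (𝟙 v)
  exact ⟨u, r, by rw [← hr, star_mul_mul_real ha]⟩

end Center

end KGraph

/-! ### The two cases of the theorem -/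

open KGraph in
theorem mainTheorem1 {k : ℕ} {Λ : Type u} [Category.{v} Λ] (G : KGraph k Λ)
    (hrow : G.RowFinite) (hns : G.NoSources) (R : Type w) [CommRing R] :
    (G.Aperiodic → G.Cofinal → Finite Λ →
      ∃ e : G.KumjianPask R, (∀ a : G.KumjianPask R, e * a = a ∧ a * e = a) ∧
        Set.center (G.KumjianPask R) = {a | ∃ r : R, a = r • e}) ∧
    (G.Cofinal → Infinite Λ → Set.center (G.KumjianPask R) = {0}) := by
  classical
  refine ⟨fun hap hcof hfin => ?_, fun hcof hinf => ?_⟩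
  · have := Fintype.ofFinite Λ
    have hone : ∀ a : G.KumjianPask R, (∑ v, G.proj R v) * a = a ∧ a * (∑ v, G.proj R v) = a := by
      intro a
      obtain ⟨F, hF⟩ := exists_finset_sum_proj_mul hrow a
      exact hF _ (Finset.subset_univ F)
    refine ⟨∑ v, G.proj R v, hone, Set.ext fun a => ?_⟩
    rw [Semigroup.mem_center_iff]
    constructor
    · intro ha
      rcases isEmpty_or_nonempty Λ with _ | ⟨⟨v⟩⟩
      -- Without vertices the identity is an empty sum, so the algebra is zero.
      · exact ⟨0, by rw [← (hone a).1, Finset.univ_eq_empty, Finset.sum_empty, zero_mul, smul_zero]⟩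
      obtain ⟨w, r, hr⟩ := hap.exists_proj_mul_eq_smul hrow hns ha v
      refine ⟨r, sub_eq_zero.1 (hcof.eq_zero_of_central hrow (w := w) (fun b => ?_) ?_)⟩
      · rw [mul_sub, sub_mul, ha, mul_smul_comm, smul_mul_assoc, (hone b).1, (hone b).2]
      · rw [mul_sub, hr, mul_smul_comm, (hone _).2, sub_self]
    · rintro ⟨r, rfl⟩ b
      rw [mul_smul_comm, smul_mul_assoc, (hone b).1, (hone b).2]
  · refine Set.ext fun a => ?_
    rw [Semigroup.mem_center_iff, Set.mem_singleton_iff]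
    constructor
    · intro ha
      obtain ⟨F, hF⟩ := exists_finset_sum_proj_mul hrow a
      -- The projection `p_w` is orthogonal to the local unit of `a`, hence annihilates `a`.
      obtain ⟨w, hw⟩ := Infinite.exists_notMem_finset F
      refine hcof.eq_zero_of_central hrow ha (w := w) ?_
      rw [← (hF F subset_rfl).1, ← mul_assoc, Finset.mul_sum, Finset.sum_eq_zero, zero_mul]
      exact fun v hv => G.proj_mul_of_ne R fun h => hw (h ▸ hv)
    · rintro rfl b
      rw [mul_zero, zero_mul]
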